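/- Let $d, L \in \mathbb{N} = \{1,2,\dots\}$, let $w_0 := d$, $w_1,\dots,w_L \in \mathbb{N}$, $w_{L+1} := 1$, and let $\sigma_1,\dots,\sigma_L \colon \mathbb{R} \to \mathbb{R}$ be continuous functions none of which is a polynomial. Let $$D := \bigl\{ \alpha = \{(A_i,b_i)\}_{i=1}^{L+1} \;\big|\; A_i \in \mathbb{R}^{w_i \times w_{i-1}},\ b_i \in \mathbb{R}^{w_i},\ i = 1,\dots,L+1 \bigr\}$$ and, for $\alpha \in D$, let $\psi(\alpha,\cdot)\colon \mathbb{R}^d \to \mathbb{R}$ be the fully connected feedforward neural network $$\psi(\alpha,x) := \bigl(\varphi_{L+1} \circ \varphi_L \circ \dots \circ \varphi_1\bigr)(x), \qquad \varphi_i(z) := \sigma_i(A_i z + b_i)\ (1 \le i \le L), \qquad \varphi_{L+1}(z) := A_{L+1} z + b_{L+1},$$ where $\sigma_i$ acts componentwise. Let $K \subset \mathbb{R}^d$ be nonempty and compact, let $C(K)$ be the space of continuous functions $K \to \mathbb{R}$ with the maximum norm, and let $\Psi \colon D \to C(K)$, $\Psi(\alpha) := \psi(\alpha,\cdot)|_K$.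 Let $Z$ be a real normed space and let $\iota\colon C(K) \to Z$ be a continuous linear map with dense image. Then the closure of $\iota(\Psi(D))$ in $Z$ is either nonconvex or equal to $Z$. -/

import Mathlib

namespace NeuralNet

/-- The widths `w₀ = d, w₁, …, w_L` of the input layer and of the `L` hidden layers; the `L` hidden
layers are indexed by `Fin L`. (The width of the output layer is `1`.) -/
def width {L : ℕ} (d : ℕ) (w : Fin L → ℕ) : Fin (L + 1) → ℕ :=
  Fin.cons (α := fun _ => ℕ) d w

/-- The parameter space `D` of a fully connected feedforward network with input dimension `d`,
`L` hidden layers of widths `w`, and one-dimensional output: all weights and biases, those of the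
hidden layers being `A i`, `b i`, and those of the affine output layer being `Aout`, `bout`. -/
structure Params {L : ℕ} (d : ℕ) (w : Fin L → ℕ) where
  A : (i : Fin L) → Matrix (Fin (width d w i.succ)) (Fin (width d w i.castSucc)) ℝ
  b : (i : Fin L) → Fin (width d w i.succ) → ℝ
  Aout : Matrix (Fin 1) (Fin (width d w (Fin.last L))) ℝ
  bout : Fin 1 → ℝ

variable {L d : ℕ} {w : Fin L → ℕ}

/-- The output vector of layer `i` (layer `0` being the input): each hidden layer maps `z` to
`σ (A z + b)`, with the activation of that layer acting componentwise. -/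
def layer (σ : Fin L → C(ℝ, ℝ)) (α : Params d w) (x : EuclideanSpace ℝ (Fin d)) :
    (i : Fin (L + 1)) → Fin (width d w i) → ℝ :=
  Fin.induction (motive := fun i => Fin (width d w i) → ℝ)
    (fun j : Fin d => x j)
    (fun i z k => σ i ((Matrix.mulVec (α.A i) z + α.b i) k))

/-- The network `ψ(α, x) = A_{L+1} z + b_{L+1}`, where `z` is the output of the last hidden
layer. -/
def psi (σ : Fin L → C(ℝ, ℝ)) (α : Params d w) (x : EuclideanSpace ℝ (Fin d)) : ℝ :=
  (Matrix.mulVec α.Aout (layer σ α x (Fin.last L)) + α.bout) 0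

theorem continuous_layer (σ : Fin L → C(ℝ, ℝ)) (α : Params d w) (i : Fin (L + 1)) :
    Continuous (fun x => layer σ α x i) := by
  induction i using Fin.induction with
  | zero =>
    have h : Continuous (fun (x : EuclideanSpace ℝ (Fin d)) (j : Fin d) => x j) := by fun_prop
    exact h
  | succ i ih =>
    refine continuous_pi fun k => (σ i).continuous.comp ?_
    exact (continuous_apply k).comp ((continuous_const.matrix_mulVec ih).add continuous_const)

theorem continuous_psi (σ : Fin L → C(ℝ, ℝ)) (α : Params d w) : Continuous (psi σ α) :=
  (continuous_apply (0 : Fin 1)).comp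
    ((continuous_const.matrix_mulVec (continuous_layer σ α (Fin.last L))).add continuous_const)

/-- The operator `Ψ : D → C(K)`, `Ψ(α) = ψ(α, ·)|_K`. -/
def Psi (σ : Fin L → C(ℝ, ℝ)) (K : Set (EuclideanSpace ℝ (Fin d))) (α : Params d w) : C(K, ℝ) :=
  ⟨fun x => psi σ α (x : EuclideanSpace ℝ (Fin d)),
    (continuous_psi σ α).comp continuous_subtype_val⟩

/-- A real function is polynomial if it is the evaluation map of some real polynomial. -/
def IsPolynomialFun (f : ℝ → ℝ) : Prop :=
  ∃ p : Polynomial ℝ, ∀ t : ℝ, f t = p.eval t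

end NeuralNet

namespace NeuralNet

open MeasureTheory Filter Topology Polynomial
open scoped Convolution ContDiff

/-! Scaling the output layer scales the network, so the closure, if convex, is a closed subspace of
`Z`. Its preimage `V` under `ι` is a closed subspace of `C(K)` containing every network. It suffices
that `V` is all of `C(K)`, since `ι` has dense range.

Because `V` is closed under sums, one neuron per layer is enough. If `V` contains `σ (a u + b)` for
all `a`, `b`, it contains `g (a u + b)` for every mollification `g` of `σ`; differentiating `n`
times in `a` at `a = 0` gives `g⁽ⁿ⁾(b) uⁿ ∈ V`. As `σ` is not a polynomial, some factor `g⁽ⁿ⁾(b)` is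
nonzero, so `uⁿ ∈ V` (`pow_mem_of_comp_mem`). The case `n = 1` carries membership from each layer
back to the previous one. At the input layer, all powers of linear forms `u` lie in `V`, hence so
does `exp u`, and Stone–Weierstrass concludes (`eq_top_of_pow_mem`). -/

/-! ### Polynomials: vanishing derivatives and pointwise limits. -/

theorem exists_derivative_eq (p : ℝ[X]) :
    ∃ q : ℝ[X], q.derivative = p ∧ q.natDegree ≤ p.natDegree + 1 := by
  refine ⟨∑ i ∈ Finset.range (p.natDegree + 1), monomial (i + 1) (p.coeff i / (i + 1)), ?_, ?_⟩
  · conv_rhs => rw [p.as_sum_range]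
    rw [derivative_sum]
    refine Finset.sum_congr rfl fun i _ => ?_
    rw [derivative_monomial]
    congr 1
    push_cast
    field_simp
  · refine natDegree_sum_le_of_forall_le _ _ fun i hi => ?_
    refine (natDegree_monomial_le _).trans ?_
    have := Finset.mem_range.1 hi
    omega

/-- The degree bound, not sharp, is what lets the conclusion survive a limit over mollifications. -/
theorem exists_polynomial_of_iteratedDeriv_eq_zero (n : ℕ) {g : ℝ → ℝ} (hg : ContDiff ℝ ∞ g)
    (h : ∀ t, iteratedDeriv n g t = 0) :
    ∃ p : ℝ[X], p.natDegree ≤ n ∧ ∀ t, g t = p.eval t := by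
  induction n generalizing g with
  | zero => exact ⟨0, by simp, fun t => by simpa using h t⟩
  | succ n ih =>
    obtain ⟨p, hpn, hp⟩ := ih (g := deriv g) (by fun_prop)
      (fun t => by rw [← iteratedDeriv_succ']; exact h t)
    obtain ⟨q, hq, hqn⟩ := exists_derivative_eq p
    have hconst : ∀ t, g t - q.eval t = g 0 - q.eval 0 := fun t => by
      refine is_const_of_deriv_eq_zero (f := fun t => g t - q.eval t) ?_ ?_ t 0
      · exact (hg.differentiable (by simp)).sub q.differentiable
      · intro s
        rw [deriv_fun_sub (hg.differentiable (by simp) s) q.differentiableAt, hp s,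
          Polynomial.deriv, hq, sub_self]
    refine ⟨q + C (g 0 - q.eval 0), ?_, fun t => ?_⟩
    · rw [natDegree_add_C]; omega
    · rw [eval_add, eval_C, ← hconst t]; ring

/-- Real polynomial functions of bounded degree are closed under pointwise limits. -/
theorem isPolynomialFun_of_tendsto (n : ℕ) {f : ℝ → ℝ} {g : ℕ → ℝ → ℝ}
    (hg : ∀ k, ∃ p : ℝ[X], p.natDegree ≤ n ∧ ∀ t, g k t = p.eval t)
    (hlim : ∀ t, Tendsto (fun k => g k t) atTop (𝓝 (f t))) :
    ∃ p : ℝ[X], ∀ t : ℝ, f t = p.eval t := by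
  let s := Finset.range (n + 1)
  let v : ℕ → ℝ := fun i => i
  have hv : Set.InjOn v s := fun i _ j _ h => Nat.cast_injective h
  -- Polynomials of degree at most `n` are determined linearly by their values at `0, …, n`, and
  -- these values converge.
  refine ⟨Lagrange.interpolate s v fun i => f (v i), fun t => ?_⟩
  refine tendsto_nhds_unique (hlim t) ?_
  have key : ∀ k, g k t = ∑ i ∈ s, g k (v i) * (Lagrange.basis s v i).eval t := fun k => by
    obtain ⟨p, hpn, hp⟩ := hg k
    have hdeg : p.degree < s.card := by
      refine lt_of_le_of_lt (degree_le_of_natDegree_le hpn) ?_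
      simp only [s, Finset.card_range]
      exact_mod_cast Nat.lt_succ_self n
    have h := congrArg (eval t) (Lagrange.eq_interpolate hv hdeg)
    simp only [Lagrange.interpolate_apply, eval_finsetSum, eval_mul, eval_C] at h
    rw [hp t, h]
    simp only [hp]
  simp only [key, Lagrange.interpolate_apply, eval_finsetSum, eval_mul, eval_C]
  exact tendsto_finsetSum _ fun i _ => (hlim (v i)).mul_const _

/-! ### Closed subspaces of `C(X)` containing `σ (a u + b)`. -/

variable {X : Type*} [TopologicalSpace X]

theorem continuous_comp_smul_add (f : C(ℝ, ℝ)) (u : C(X, ℝ)) {α β : ℝ → ℝ} (hα : Continuous α)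
    (hβ : Continuous β) :
    Continuous fun s => f.comp (α s • u + ContinuousMap.const X (β s)) := by
  refine ContinuousMap.continuous_of_continuous_uncurry _ ?_
  change Continuous fun q : ℝ × X => f (α q.1 * u q.2 + β q.1)
  fun_prop

variable [CompactSpace X]

/-- The convolution is a Bochner integral of translates of `σ`; since `V` is complete, the integral
can be taken inside `V`. -/
theorem comp_convolution_mem {V : Submodule ℝ C(X, ℝ)} (hV : IsClosed (V : Set C(X, ℝ)))
    (u : C(X, ℝ)) (σ : C(ℝ, ℝ)) {φ : ℝ → ℝ} (hφ : Continuous φ) (hφc : HasCompactSupport φ)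
    (h : ∀ a b : ℝ, σ.comp (a • u + ContinuousMap.const X b) ∈ V) (g : C(ℝ, ℝ))
    (hg : ⇑g = φ ⋆[ContinuousLinearMap.lsmul ℝ ℝ, volume] σ) (a b : ℝ) :
    g.comp (a • u + ContinuousMap.const X b) ∈ V := by
  have : CompleteSpace V := hV.completeSpace_coe
  let c : ℝ → C(X, ℝ) := fun s => σ.comp (a • u + ContinuousMap.const X (b - s))
  have hc : Continuous c := continuous_comp_smul_add σ u continuous_const (by fun_prop)
  let F : ℝ → V := fun s => φ s • ⟨c s, h a (b - s)⟩
  have hF : Continuous F := hφ.smul (hc.subtype_mk _)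
  have hFi : Integrable F := hF.integrable_of_hasCompactSupport hφc.smul_right
  have hFi' : Integrable (fun s => φ s • c s) :=
    (hφ.smul hc).integrable_of_hasCompactSupport hφc.smul_right
  have hmem : (∫ s, φ s • c s) ∈ V := by
    have h1 : (∫ s, φ s • c s) = V.subtypeL (∫ s, F s) := 
      ContinuousLinearMap.integral_comp_comm (𝕜 := ℝ) V.subtypeL hFi
    rw [h1]
    exact (∫ s, F s).2
  have heq : g.comp (a • u + ContinuousMap.const X b) = ∫ s, φ s • c s := by
    ext x
    rw [ContinuousMap.integral_apply hFi', ContinuousMap.comp_apply, hg, convolution_def]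
    refine integral_congr_ae (Eventually.of_forall fun s => ?_)
    simp [c, add_sub_assoc]
  rw [heq]
  exact hmem

/-- To pass from pointwise to sup-norm differentiability, the curve is written as the integral of
its continuous candidate derivative. -/
theorem hasDerivAt_pow_mul_comp (u : C(X, ℝ)) (f f' : C(ℝ, ℝ)) (hf : ∀ t, HasDerivAt f (f' t) t)
    (n : ℕ) (a b : ℝ) :
    HasDerivAt (fun a : ℝ => u ^ n * f.comp (a • u + ContinuousMap.const X b))
      (u ^ (n + 1) * f'.comp (a • u + ContinuousMap.const X b)) a := by
  let c' : ℝ → C(X, ℝ) := fun a => u ^ (n + 1) * f'.comp (a • u + ContinuousMap.const X b)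
  have hc' : Continuous c' :=
    continuous_const.mul (continuous_comp_smul_add f' u continuous_id continuous_const)
  have hint : ∀ a : ℝ, u ^ n * f.comp (a • u + ContinuousMap.const X b) =
      u ^ n * f.comp ((0 : ℝ) • u + ContinuousMap.const X b) + ∫ s in (0 : ℝ)..a, c' s := by
    intro a
    ext x
    have h1 : (∫ s in (0 : ℝ)..a, c' s) x = ∫ s in (0 : ℝ)..a, c' s x :=
      ((ContinuousMap.evalCLM ℝ x).intervalIntegral_comp_comm
        (hc'.intervalIntegrable 0 a)).symm
    have h2 : ∀ s : ℝ, HasDerivAt (fun s : ℝ => u x ^ n * f (s * u x + b)) (c' s x) s := by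
      intro s
      have h3 : HasDerivAt (fun s : ℝ => s * u x + b) (u x) s := by
        simpa using ((hasDerivAt_id s).mul_const (u x)).add_const b
      convert! ((hf (s * u x + b)).comp s h3).const_mul (u x ^ n) using 1
      simp [c']; ring
    have h4 := intervalIntegral.integral_eq_sub_of_hasDerivAt (a := 0) (b := a) (fun s _ => h2 s)
      (((continuous_eval_const x).comp hc').intervalIntegrable 0 a)
    rw [ContinuousMap.add_apply, h1, h4]
    simp
  rw [show (fun a : ℝ => u ^ n * f.comp (a • u + ContinuousMap.const X b)) = _ from funext hint]
  exact (hc'.integral_hasStrictDerivAt 0 a).hasDerivAt.const_add _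

theorem pow_mul_comp_deriv_mem {V : Submodule ℝ C(X, ℝ)} (hV : IsClosed (V : Set C(X, ℝ)))
    (u : C(X, ℝ)) (f f' : C(ℝ, ℝ)) (hf : ∀ t, HasDerivAt f (f' t) t) (n : ℕ)
    (h : ∀ a b : ℝ, u ^ n * f.comp (a • u + ContinuousMap.const X b) ∈ V) (a b : ℝ) :
    u ^ (n + 1) * f'.comp (a • u + ContinuousMap.const X b) ∈ V := by
  have hd := hasDerivAt_iff_tendsto_slope.1 (hasDerivAt_pow_mul_comp u f f' hf n a b)
  refine hV.mem_of_tendsto hd (Eventually.of_forall fun s => ?_)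
  rw [slope_def_module]
  exact V.smul_mem _ (V.sub_mem (h s b) (h a b))

theorem pow_mul_comp_iteratedDeriv_mem {V : Submodule ℝ C(X, ℝ)}
    (hV : IsClosed (V : Set C(X, ℝ))) (u : C(X, ℝ)) (g : C(ℝ, ℝ)) (hg : ContDiff ℝ ∞ g)
    (h : ∀ a b : ℝ, g.comp (a • u + ContinuousMap.const X b) ∈ V) (n : ℕ) (a b : ℝ) :
    u ^ n * ContinuousMap.comp ⟨iteratedDeriv n g, hg.continuous_iteratedDeriv n (mod_cast le_top)⟩
      (a • u + ContinuousMap.const X b) ∈ V := by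
  induction n generalizing a b with
  | zero => simpa using! h a b
  | succ n ih =>
    refine pow_mul_comp_deriv_mem hV u _ _ (fun t => ?_) n ih a b
    change HasDerivAt (iteratedDeriv n g) (iteratedDeriv (n + 1) g t) t
    rw [iteratedDeriv_succ]
    exact (hg.differentiable_iteratedDeriv n (mod_cast ENat.natCast_lt_top n) t).hasDerivAt

/-- A closed subspace of `C(X)` that contains `σ (a u + b)` for all real `a`, `b`, where `σ` is
continuous and not a polynomial, contains all powers of `u`. -/
theorem pow_mem_of_comp_mem {V : Submodule ℝ C(X, ℝ)} (hV : IsClosed (V : Set C(X, ℝ)))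
    (u : C(X, ℝ)) (σ : C(ℝ, ℝ)) (hσ : ¬ ∃ p : ℝ[X], ∀ t : ℝ, σ t = p.eval t)
    (h : ∀ a b : ℝ, σ.comp (a • u + ContinuousMap.const X b) ∈ V) (n : ℕ) : u ^ n ∈ V := by
  let φ : ℕ → ContDiffBump (0 : ℝ) := fun k =>
    ⟨1 / ((k : ℝ) + 1) / 2, 1 / ((k : ℝ) + 1), by positivity, half_lt_self (by positivity)⟩
  have hsmooth : ∀ k, ContDiff ℝ ∞
      ((φ k).normed volume ⋆[ContinuousLinearMap.lsmul ℝ ℝ, volume] σ) := fun k =>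
    (φ k).hasCompactSupport_normed.contDiff_convolution_left _ (φ k).contDiff_normed
      σ.continuous.locallyIntegrable
  -- If `u ^ n` were missing, the `n`-th derivative of every mollification would vanish identically,
  -- making `σ` a limit of polynomials of degree at most `n`.
  by_contra hn
  refine hσ (isPolynomialFun_of_tendsto n
    (g := fun k => (φ k).normed volume ⋆[ContinuousLinearMap.lsmul ℝ ℝ, volume] σ)
    (fun k => exists_polynomial_of_iteratedDeriv_eq_zero n (hsmooth k) fun t => ?_)
    fun t => ContDiffBump.convolution_tendsto_right_of_continuous
      tendsto_one_div_add_atTop_nhds_zero_nat σ.continuous t)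
  by_contra ht
  let g : C(ℝ, ℝ) := ⟨_, (hsmooth k).continuous⟩
  have hmem := pow_mul_comp_iteratedDeriv_mem hV u g (hsmooth k)
    (comp_convolution_mem hV u σ (φ k).continuous_normed (φ k).hasCompactSupport_normed h g rfl)
    -- With `a = 0` and `b = t`, the derivative factor is the nonzero constant `iteratedDeriv n g
    -- t`.
    n 0 t
  refine hn ?_
  convert V.smul_mem (iteratedDeriv n g t)⁻¹ hmem using 1
  ext x
  have ht' : iteratedDeriv n g t ≠ 0 := ht
  simp
  field_simp

/-- A closed subspace of `C(X)` that contains all powers of the elements of a point-separating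
additive subgroup of `C(X)` is everything. -/
theorem eq_top_of_pow_mem {V : Submodule ℝ C(X, ℝ)} (hV : IsClosed (V : Set C(X, ℝ)))
    (U : AddSubgroup C(X, ℝ)) (hU : ∀ x y : X, x ≠ y → ∃ u ∈ U, u x ≠ u y)
    (h : ∀ u ∈ U, ∀ n : ℕ, u ^ n ∈ V) : V = ⊤ := by
  -- Since `exp u * exp v = exp (u + v)`, the linear span of the exponentials is already an algebra.
  let E : Submonoid C(X, ℝ) :=
    { carrier := NormedSpace.exp '' U
      one_mem' := ⟨0, U.zero_mem, NormedSpace.exp_zero⟩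
      mul_mem' := by
        rintro _ _ ⟨u, hu, rfl⟩ ⟨v, hv, rfl⟩
        exact ⟨u + v, U.add_mem hu hv, NormedSpace.exp_add⟩ }
  have hEV : (E : Set C(X, ℝ)) ⊆ V := by
    rintro _ ⟨u, hu, rfl⟩
    exact hV.mem_of_tendsto (NormedSpace.exp_series_hasSum_exp' (𝕂 := ℝ) u)
      (Eventually.of_forall fun s => V.sum_mem fun n _ => V.smul_mem _ (h u hu n))
  let A : Subalgebra ℝ C(X, ℝ) := Algebra.adjoin ℝ (E : Set C(X, ℝ))
  have hA : A.SeparatesPoints := by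
    intro x y hxy
    obtain ⟨u, hu, hne⟩ := hU x y hxy
    refine ⟨_, ⟨NormedSpace.exp u, Algebra.subset_adjoin ⟨u, hu, rfl⟩, rfl⟩, ?_⟩
    have hev : ∀ z : X, (NormedSpace.exp u) z = Real.exp (u z) := fun z => by
      rw [Real.exp_eq_exp_ℝ]
      exact NormedSpace.map_exp (ContinuousMap.evalAlgHom ℝ ℝ z)
        (continuous_eval_const z) u
    simpa [hev] using hne
  have hAV : (A : Set C(X, ℝ)) ⊆ V := by
    have hspan : Subalgebra.toSubmodule A = Submodule.span ℝ (E : Set C(X, ℝ)) := by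
      rw [Algebra.adjoin_eq_span, Submonoid.closure_eq]
    intro f hf
    have : f ∈ Subalgebra.toSubmodule A := hf
    rw [hspan] at this
    exact Submodule.span_le.2 hEV this
  have htop := ContinuousMap.subalgebra_topologicalClosure_eq_top_of_separatesPoints A hA
  refine eq_top_iff.2 fun f _ => ?_
  have hf : f ∈ closure (A : Set C(X, ℝ)) := by
    rw [← Subalgebra.topologicalClosure_coe, htop]
    trivial
  exact closure_minimal hAV hV hf

/-! ### Networks: descending from the output to the input layer. -/

theorem layer_succ {L d : ℕ} {w : Fin L → ℕ} (σ : Fin L → C(ℝ, ℝ)) (α : Params d w)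
    (x : EuclideanSpace ℝ (Fin d)) (i : Fin L) (k : Fin (width d w i.succ)) :
    layer σ α x i.succ k = σ i ((Matrix.mulVec (α.A i) (layer σ α x i.castSucc) + α.b i) k) :=
  rfl

theorem layer_congr {L d : ℕ} {w : Fin L → ℕ} (σ : Fin L → C(ℝ, ℝ)) {α β : Params d w}
    (x : EuclideanSpace ℝ (Fin d)) (i : Fin (L + 1))
    (h : ∀ j : Fin L, j.castSucc < i → α.A j = β.A j ∧ α.b j = β.b j) :
    layer σ α x i = layer σ β x i := by
  induction i using Fin.induction with
  | zero => rfl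
  | succ i ih =>
    have hi := h i (Fin.castSucc_lt_succ)
    have hl := ih fun j hj => h j (hj.trans (Fin.castSucc_lt_succ))
    funext k
    rw [layer_succ, layer_succ, hl, hi.1, hi.2]

/-- The linear functional `r` of the output of layer `i`, as a continuous function on `K`. -/
def layerFunctional {L d : ℕ} {w : Fin L → ℕ} (σ : Fin L → C(ℝ, ℝ))
    (K : Set (EuclideanSpace ℝ (Fin d))) (α : Params d w) (i : Fin (L + 1))
    (r : Fin (width d w i) → ℝ) : C(K, ℝ) :=
  ⟨fun x => r ⬝ᵥ layer σ α x i,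
    continuous_const.dotProduct ((continuous_layer σ α i).comp continuous_subtype_val)⟩

/-- For every functional `u` of layer `i`, the function `σᵢ (a u + b)` is a functional of the next
layer, for other parameters. -/
theorem exists_layerFunctional_succ {L d : ℕ} {w : Fin L → ℕ} (hw : ∀ i, 1 ≤ w i)
    (σ : Fin L → C(ℝ, ℝ)) (K : Set (EuclideanSpace ℝ (Fin d))) (α : Params d w) (i : Fin L)
    (r : Fin (width d w i.castSucc) → ℝ) (a b : ℝ) :
    ∃ (β : Params d w) (s : Fin (width d w i.succ) → ℝ), layerFunctional σ K β i.succ s =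
      (σ i).comp (a • layerFunctional σ K α i.castSucc r + ContinuousMap.const K b) := by
  -- Every neuron of layer `i` now computes `σᵢ (a u + b)`; earlier layers are untouched, and one
  -- neuron is read off.
  let β : Params d w :=
    { α with
      A := Function.update α.A i (Matrix.of fun _ => a • r)
      b := Function.update α.b i fun _ => b }
  let k : Fin (width d w i.succ) := ⟨0, hw i⟩
  have hl : ∀ x, layer σ β x i.castSucc = layer σ α x i.castSucc := fun x =>
    layer_congr σ x _ fun j hj => by
      have hne : j ≠ i := fun h => by simp [h] at hj
      exact ⟨Function.update_of_ne hne _ _, Function.update_of_ne hne _ _⟩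
  refine ⟨β, Pi.single k 1, ?_⟩
  ext x
  change Pi.single k 1 ⬝ᵥ layer σ β x i.succ =
    σ i (a * (r ⬝ᵥ layer σ α x i.castSucc) + b)
  rw [single_one_dotProduct, layer_succ, hl]
  have hA : β.A i = Matrix.of fun _ => a • r := Function.update_self i _ _
  have hb : β.b i = fun _ => b := Function.update_self i _ _
  rw [hA, hb]
  congr 1
  change (a • r) ⬝ᵥ layer σ α x i.castSucc + b = _
  rw [smul_dotProduct, smul_eq_mul]

/-- If a closed subspace of `C(K)` contains all functionals of a layer, it contains all powers of
functionals of the previous one. -/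
theorem layerFunctional_pow_mem {L d : ℕ} {w : Fin L → ℕ} (hw : ∀ i, 1 ≤ w i)
    (σ : Fin L → C(ℝ, ℝ)) (hσ : ∀ i, ¬ IsPolynomialFun (σ i))
    {K : Set (EuclideanSpace ℝ (Fin d))} [CompactSpace K] {V : Submodule ℝ C(K, ℝ)}
    (hV : IsClosed (V : Set C(K, ℝ))) (i : Fin L)
    (h : ∀ (α : Params d w) (r : Fin (width d w i.succ) → ℝ), layerFunctional σ K α i.succ r ∈ V)
    (α : Params d w) (r : Fin (width d w i.castSucc) → ℝ) (n : ℕ) :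
    layerFunctional σ K α i.castSucc r ^ n ∈ V := by
  refine pow_mem_of_comp_mem hV _ (σ i) (hσ i) (fun a b => ?_) n
  obtain ⟨β, s, hs⟩ := exists_layerFunctional_succ hw σ K α i r a b
  rw [← hs]
  exact h β s

theorem layerFunctional_mem {L d : ℕ} {w : Fin L → ℕ} (hw : ∀ i, 1 ≤ w i)
    (σ : Fin L → C(ℝ, ℝ)) (hσ : ∀ i, ¬ IsPolynomialFun (σ i))
    {K : Set (EuclideanSpace ℝ (Fin d))} [CompactSpace K] {V : Submodule ℝ C(K, ℝ)}
    (hV : IsClosed (V : Set C(K, ℝ))) (h : ∀ α : Params d w, Psi σ K α ∈ V) (i : Fin (L + 1))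
    (α : Params d w) (r : Fin (width d w i) → ℝ) : layerFunctional σ K α i r ∈ V := by
  induction i using Fin.reverseInduction generalizing α with
  | last =>
    convert h { α with Aout := Matrix.of fun _ => r, bout := 0 } using 1
    ext x
    let β : Params d w := { α with Aout := Matrix.of fun _ => r, bout := 0 }
    have hl : layer σ β x (Fin.last L) = layer σ α x (Fin.last L) :=
      layer_congr (α := β) (β := α) σ x _ fun _ _ => ⟨rfl, rfl⟩
    change r ⬝ᵥ layer σ α x (Fin.last L) = r ⬝ᵥ layer σ β x (Fin.last L) + 0
    rw [hl, add_zero]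
  | cast i ih =>
    simpa using layerFunctional_pow_mem hw σ hσ hV i ih α r 1

/-- Universal approximation: the only closed subspace of `C(K)` that contains all networks of a
given architecture is `C(K)` itself. -/
theorem eq_top_of_Psi_mem {L d : ℕ} {w : Fin L → ℕ} (hL : 1 ≤ L) (hw : ∀ i, 1 ≤ w i)
    (σ : Fin L → C(ℝ, ℝ)) (hσ : ∀ i, ¬ IsPolynomialFun (σ i))
    {K : Set (EuclideanSpace ℝ (Fin d))} [CompactSpace K] {V : Submodule ℝ C(K, ℝ)}
    (hV : IsClosed (V : Set C(K, ℝ))) (h : ∀ α : Params d w, Psi σ K α ∈ V) : V = ⊤ := by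
  obtain ⟨M, rfl⟩ : ∃ M, L = M + 1 := ⟨L - 1, by omega⟩
  -- The input layer does not depend on the parameters, so any choice serves.
  let α : Params d w := ⟨fun _ => 0, fun _ => 0, 0, 0⟩
  let U : AddSubgroup C(K, ℝ) :=
    { carrier := Set.range (layerFunctional σ K α (Fin.castSucc 0))
      zero_mem' := ⟨0, by ext x; exact zero_dotProduct (layer σ α x.1 (Fin.castSucc 0))⟩
      add_mem' := by
        rintro _ _ ⟨r, rfl⟩ ⟨s, rfl⟩
        exact ⟨r + s, by ext x; exact add_dotProduct r s (layer σ α x.1 (Fin.castSucc 0))⟩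
      neg_mem' := by
        rintro _ ⟨r, rfl⟩
        exact ⟨-r, by ext x; exact neg_dotProduct r (layer σ α x.1 (Fin.castSucc 0))⟩ }
  refine eq_top_of_pow_mem hV U (fun x y hxy => ?_) ?_
  · obtain ⟨j, hj⟩ : ∃ j : Fin d, x.1 j ≠ y.1 j := by
      by_contra! hall
      exact hxy (Subtype.ext (PiLp.ext hall))
    refine ⟨_, ⟨(Pi.single j 1 : Fin d → ℝ), rfl⟩, ?_⟩
    change (Pi.single j 1 : Fin d → ℝ) ⬝ᵥ (fun k : Fin d => x.1 k) ≠
      (Pi.single j 1 : Fin d → ℝ) ⬝ᵥ (fun k : Fin d => y.1 k)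
    simpa using hj
  · rintro _ ⟨r, rfl⟩ n
    exact layerFunctional_pow_mem hw σ hσ hV 0 (layerFunctional_mem hw σ hσ hV h _) α r n

theorem exists_Psi_eq_smul {L d : ℕ} {w : Fin L → ℕ} (σ : Fin L → C(ℝ, ℝ))
    (K : Set (EuclideanSpace ℝ (Fin d))) (c : ℝ) (α : Params d w) :
    ∃ β : Params d w, Psi σ K β = c • Psi σ K α := by
  let β : Params d w := { α with Aout := c • α.Aout, bout := c • α.bout }
  refine ⟨β, ?_⟩
  ext x
  have hl : layer σ β x (Fin.last L) = layer σ α x (Fin.last L) :=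
    layer_congr (α := β) (β := α) σ x _ fun _ _ => ⟨rfl, rfl⟩
  change (Matrix.mulVec (c • α.Aout) (layer σ β x (Fin.last L)) + c • α.bout) 0 =
    c * (Matrix.mulVec α.Aout (layer σ α x (Fin.last L)) + α.bout) 0
  rw [hl, Matrix.smul_mulVec, ← smul_add, Pi.smul_apply, smul_eq_mul]

/-- A nonempty convex set that is invariant under all scalings is a subspace. -/
def submoduleOfConvex {E : Type*} [AddCommGroup E] [Module ℝ E] (S : Set E) (hS : Convex ℝ S)
    (hne : S.Nonempty) (hsmul : ∀ (c : ℝ), ∀ x ∈ S, c • x ∈ S) : Submodule ℝ E where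
  carrier := S
  zero_mem' := by
    obtain ⟨x, hx⟩ := hne
    simpa using hsmul 0 x hx
  add_mem' := fun {x y} hx hy => by
    -- The sum `x + y` is the midpoint of `2x` and `2y`.
    have h := hS (hsmul 2 x hx) (hsmul 2 y hy) (a := 1 / 2) (b := 1 / 2) (by norm_num)
      (by norm_num) (by norm_num)
    simpa [smul_smul] using h
  smul_mem' := fun c x hx => hsmul c x hx

end NeuralNet

/-! ### The dichotomy for the closure. -/

theorem corollary5p1 {d L : ℕ} (hd : 1 ≤ d) (hL : 1 ≤ L)
    (w : Fin L → ℕ) (hw : ∀ i, 1 ≤ w i)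
    (σ : Fin L → C(ℝ, ℝ)) (hσ : ∀ i, ¬ NeuralNet.IsPolynomialFun (σ i))
    (K : Set (EuclideanSpace ℝ (Fin d))) (hK : IsCompact K) (hKne : K.Nonempty)
    {Z : Type*} [NormedAddCommGroup Z] [NormedSpace ℝ Z]
    (ι : C(K, ℝ) →L[ℝ] Z) (hι : DenseRange ι) :
    ¬ Convex ℝ (closure (ι '' Set.range
        (NeuralNet.Psi σ K : NeuralNet.Params d w → C(K, ℝ)))) ∨
      closure (ι '' Set.range
        (NeuralNet.Psi σ K : NeuralNet.Params d w → C(K, ℝ))) = Set.univ := by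
  have : CompactSpace K := isCompact_iff_compactSpace.1 hK
  rw [or_iff_not_imp_left, not_not]
  intro hconv
  set S : Set Z := ι '' Set.range (NeuralNet.Psi σ K : NeuralNet.Params d w → C(K, ℝ))
  have hne : (closure S).Nonempty :=
    ⟨_, subset_closure ⟨_, ⟨⟨fun _ => 0, fun _ => 0, 0, 0⟩, rfl⟩, rfl⟩⟩
  have hsmul : ∀ c : ℝ, ∀ z ∈ closure S, c • z ∈ closure S := fun c z hz => by
    refine map_mem_closure (continuous_const_smul c) hz ?_
    rintro _ ⟨_, ⟨α, rfl⟩, rfl⟩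
    obtain ⟨β, hβ⟩ := NeuralNet.exists_Psi_eq_smul σ K c α
    exact ⟨_, ⟨β, hβ⟩, map_smul ι c _⟩
  let W := NeuralNet.submoduleOfConvex (closure S) hconv hne hsmul
  have hVtop : W.comap ι.toLinearMap = ⊤ :=
    NeuralNet.eq_top_of_Psi_mem hL hw σ hσ (isClosed_closure.preimage ι.continuous)
      fun α => subset_closure (Set.mem_image_of_mem ι ⟨α, rfl⟩)
  refine Set.eq_univ_of_univ_subset ?_
  rw [← hι.closure_range]
  refine closure_minimal ?_ isClosed_closure
  rintro _ ⟨f, rfl⟩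
  have hf : f ∈ W.comap ι.toLinearMap := hVtop ▸ Submodule.mem_top
  exact hf
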